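/- Let $(X,\rho)$ be a compact metric space, $T\colon X\to X$ a continuous map, and $\mu$ a $T$-invariant Borel probability measure on $X$. Write $C(X)$ for the continuous functions $X\to\mathbb C$ and $\mathbb S^1=\{\xi\in\mathbb C:|\xi|=1\}$. For $f\in C(X)$, $\xi\in\mathbb S^1$, $x\in X$ and $n\ge 1$ put $$\mathrm{Av}_n[f,\bar\xi](x)=\frac1n\sum_{j=0}^{n-1}\xi^{-j}f(T^jx),\qquad \mathrm{Av}[f,\bar\xi](x)=\lim_{n\to\infty}\mathrm{Av}_n[f,\bar\xi](x)\ \text{ (when the limit exists)},$$ and let $\mathrm{Freq}(x)$ be the set of all $\xi\in\mathbb S^1$ such that $\limsup_{n\to\infty}|\mathrm{Av}_n[f,\bar\xi](x)|>0$ for some $f\in C(X)$. Let $\mathcal K\subseteq L^2(X,\mu)$ be the closed linear span of the eigenfunctions of the Koopman operator $U_Tf=f\circ T$ on the complex Hilbert space $L^2(X,\mu)$, and let $P_{\mathcal K}$ be the orthogonal projection onto $\mathcal K$. A point $x\in X$ is a Wiener–Wintner $\mu$-generic point if $\lim_{n\to\infty}\frac1n\sum_{j=0}^{n-1}f(T^jx)=\int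 f\,d\mu$ for every $f\in C(X)$ and the sequence $(\mathrm{Av}_n[f,\bar\xi](x))_{n\ge1}$ converges for every $f\in C(X)$ and every $\xi\in\mathbb S^1$. Such a point is regular if $$\|P_{\mathcal K}f\|_2^2=\sum_{\xi\in\mathrm{Freq}(x)}|\mathrm{Av}[f,\bar\xi](x)|^2\qquad\text{for every } f\in C(X).$$ Then the following conditions are equivalent: (i) $\mu$ is ergodic; (ii) there is a Borel set $\hat X_\mu\subseteq X$ with $\mu(\hat X_\mu)=1$ such that every $x\in\hat X_\mu$ is a regular Wiener–Wintner $\mu$-generic point; (iii) there exists a regular Wiener–Wintner $\mu$-generic point. -/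

import Mathlib

open MeasureTheory Filter Topology

noncomputable section

namespace WienerWintner

section Topological

variable {X : Type*} [TopologicalSpace X]

/-- The twisted ergodic average `(1/n) ∑_{j<n} ξ^{-j} f (T^j x)`. -/
def av (T : X → X) (f : X → ℂ) (ξ : Circle) (n : ℕ) (x : X) : ℂ :=
  (1 / (n : ℂ)) * ∑ j ∈ Finset.range n, (ξ : ℂ) ^ (-(j : ℤ)) * f (T^[j] x)

/-- The limit of the twisted averages; it is only used at points where the limit exists. -/
def avLim (T : X → X) (f : X → ℂ) (ξ : Circle) (x : X) : ℂ :=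
  limUnder atTop (fun n : ℕ => av T f ξ n x)

/-- The set of frequencies of the point `x`. The sequence of moduli is bounded by `‖f‖`
when `X` is compact, so the real `limsup` is the genuine one. -/
def Freq (T : X → X) (x : X) : Set Circle :=
  {ξ | ∃ f : C(X, ℂ), 0 < limsup (fun n : ℕ => ‖av T f ξ n x‖) atTop}

/-- `x` is a generic point for `μ`. -/
def IsGeneric [MeasurableSpace X] (T : X → X) (μ : Measure X) (x : X) : Prop :=
  ∀ f : C(X, ℂ), Tendsto
    (fun n : ℕ => (1 / (n : ℂ)) * ∑ j ∈ Finset.range n, f (T^[j] x)) atTop (𝓝 (∫ y, f y ∂μ))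

/-- `x` is a Wiener-Wintner generic point for `μ`. -/
def IsWWGeneric [MeasurableSpace X] (T : X → X) (μ : Measure X) (x : X) : Prop :=
  IsGeneric T μ x ∧
    ∀ (f : C(X, ℂ)) (ξ : Circle), ∃ l : ℂ, Tendsto (fun n : ℕ => av T f ξ n x) atTop (𝓝 l)

end Topological

section Spectral

variable {X : Type*} [MeasurableSpace X] {μ : Measure X} {T : X → X}

/-- The Koopman operator `f ↦ f ∘ T` on the complex Hilbert space `L²(μ)`. -/
def koopman (hT : MeasurePreserving T μ μ) : Lp ℂ 2 μ →ₗᵢ[ℂ] Lp ℂ 2 μ :=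
  Lp.compMeasurePreservingₗᵢ ℂ T hT

/-- The closed linear span in `L²(μ)` of all eigenfunctions of the Koopman operator. -/
abbrev kronecker (hT : MeasurePreserving T μ μ) : Submodule ℂ (Lp ℂ 2 μ) :=
  (Submodule.span ℂ {g : Lp ℂ 2 μ |
    ∃ c : ℂ, Module.End.HasEigenvector (koopman hT).toLinearMap c g}).topologicalClosure

end Spectral

/-- `x` is a regular Wiener-Wintner generic point for `μ`: moreover, for every continuous `f`,
the family `|Av[f, ξ̄](x)|²`, `ξ ∈ Freq(x)`, is summable with sum the square of the `L²`-norm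
of the orthogonal projection of `f` onto the closed span of the eigenfunctions. -/
def IsRegularWWGeneric {X : Type*} [TopologicalSpace X] [CompactSpace X] [MeasurableSpace X]
    [BorelSpace X] {μ : Measure X} [IsFiniteMeasure μ] {T : X → X}
    (hT : MeasurePreserving T μ μ) (x : X) : Prop :=
  IsWWGeneric T μ x ∧
    ∀ f : C(X, ℂ), HasSum (fun ξ : Freq T x => ‖avLim T f (ξ : Circle) x‖ ^ 2)
      (‖(kronecker hT).starProjection (ContinuousMap.toLp 2 μ ℂ f)‖ ^ 2)

end WienerWintner

end

/-! Both directions compare pointwise twisted averages with the spectral theory of the Koopman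
operator `U` on `L²(μ)`. At a generic `x`, Cauchy–Schwarz gives `limsup |Av_n f|² ≤ ‖f‖₂²`, so every
limit of the averages at `ξ` extends to a bounded functional `a` on `L²` with `a ∘ U = ξ a`
(`exists_functional_of_tendsto`).

If `μ` is ergodic, almost every point is generic by Birkhoff's theorem. When `ξ` is not an
eigenvalue, the Riesz vector of `a` would be an eigenvector, so `a = 0`; this holds at every generic
point, with no exceptional set depending on `ξ`. The eigenvalues are countable, and at each one
Birkhoff's theorem for `f · conj v`, with `v` a normalized eigenfunction, gives a limit of modulus
`|⟨v, f⟩|`. Eigenspaces are lines, so Parseval on the Kronecker subspace is the regularity identity.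

Conversely, let `h ⟂ 1` be invariant. At a regular point every `a_ξ` kills `h`, so the regularity
identity and its Bessel inequality give `‖P f‖ ≤ ‖f - h‖` for continuous `f`. Letting `f → h`, with
`P h = h`, yields `h = 0`, hence ergodicity. -/

noncomputable section

namespace WienerWintner

/-! ### Birkhoff's theorem for ergodic maps, via maximal sums -/

section Birkhoff

variable {X : Type*} {T : X → X}

/-- The running maxima `max_{1 ≤ k ≤ n + 1} ∑_{j<k} φ (T^j x)` of the Birkhoff sums. -/
def birkhoffMax (T : X → X) (φ : X → ℝ) : ℕ → X → ℝ
  | 0, x => φ x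
  | n + 1, x => φ x + max 0 (birkhoffMax T φ n (T x))

theorem le_birkhoffMax (φ : X → ℝ) (n : ℕ) (x : X) : φ x ≤ birkhoffMax T φ n x := by
  cases n <;> simp [birkhoffMax]

theorem birkhoffSum_le_birkhoffMax (φ : X → ℝ) (n : ℕ) (x : X) :
    birkhoffSum T φ (n + 1) x ≤ birkhoffMax T φ n x := by
  induction n generalizing x with
  | zero => simp [birkhoffMax, birkhoffSum_one]
  | succ n ih =>
    rw [birkhoffSum_succ', birkhoffMax]
    gcongr
    exact (ih _).trans (le_max_right _ _)

theorem birkhoffMax_le_succ (φ : X → ℝ) (n : ℕ) (x : X) :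
    birkhoffMax T φ n x ≤ birkhoffMax T φ (n + 1) x := by
  induction n generalizing x with
  | zero => simp [birkhoffMax]
  | succ n ih =>
    rw [birkhoffMax, birkhoffMax]
    gcongr
    exact ih _

/-- Makes the set of points with bounded maxima strictly invariant, so that ergodicity gives a
zero-one law for it. -/
theorem bddAbove_birkhoffMax_comp_iff (φ : X → ℝ) (x : X) :
    BddAbove (Set.range fun n => birkhoffMax T φ n (T x)) ↔
      BddAbove (Set.range fun n => birkhoffMax T φ n x) := by
  constructor
  · rintro ⟨C, hC⟩
    refine ⟨φ x + max 0 C, ?_⟩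
    rintro _ ⟨n, rfl⟩
    refine (birkhoffMax_le_succ φ n x).trans ?_
    simp only [birkhoffMax]
    gcongr
    exact hC ⟨n, rfl⟩
  · rintro ⟨C, hC⟩
    refine ⟨C - φ x, ?_⟩
    rintro _ ⟨n, rfl⟩
    have h : φ x + max 0 (birkhoffMax T φ n (T x)) ≤ C := hC ⟨n + 1, rfl⟩
    linarith [le_max_right 0 (birkhoffMax T φ n (T x))]

variable [MeasurableSpace X] {μ : Measure X}

theorem measurable_birkhoffMax (hT : Measurable T) {φ : X → ℝ} (hφ : Measurable φ) (n : ℕ) :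
    Measurable (birkhoffMax T φ n) := by
  induction n with
  | zero => exact hφ
  | succ n ih => exact hφ.add (measurable_const.max (ih.comp hT))

theorem integrable_birkhoffMax (hT : MeasurePreserving T μ μ) {φ : X → ℝ} (hφ : Integrable φ μ)
    (n : ℕ) : Integrable (birkhoffMax T φ n) μ := by
  induction n with
  | zero => exact hφ
  | succ n ih =>
    have h := (hT.integrable_comp_of_integrable ih).pos_part
    refine hφ.add (h.congr (.of_forall fun x => ?_))
    simp [max_comm]

/-- If `φ` has negative mean, the Birkhoff sums of `φ` are bounded above almost everywhere. -/
theorem ae_bddAbove_birkhoffSum (hT : Ergodic T μ) {φ : X → ℝ} (hm : Measurable φ)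
    (hφ : Integrable φ μ) (hneg : ∫ x, φ x ∂μ < 0) :
    ∀ᵐ x ∂μ, ∃ C : ℝ, ∀ n, birkhoffSum T φ n x ≤ C := by
  have hTp := hT.toMeasurePreserving
  let A : Set X := {x | BddAbove (Set.range fun n => birkhoffMax T φ n x)}
  have hA : MeasurableSet A :=
    measurableSet_bddAbove_range fun n => measurable_birkhoffMax hTp.measurable hm n
  have hinv : T ⁻¹' A = A := Set.ext fun x => bddAbove_birkhoffMax_comp_iff φ x
  rcases hT.toPreErgodic.ae_mem_or_ae_notMem hA hinv with h | h
  · filter_upwards [h] with x ⟨C, hC⟩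
    refine ⟨max 0 C, fun n => ?_⟩
    cases n with
    | zero => simp
    | succ n => exact (birkhoffSum_le_birkhoffMax φ n x).trans ((hC ⟨n, rfl⟩).trans (le_max_right _ _))
  · exfalso
    -- The integrand is `φ` plus the negative part of the maximum at `T x`. That part is at most `|φ
    -- (T x)|`, and vanishes eventually when the maxima are unbounded.
    have hlim : Tendsto (fun n => ∫ x, (birkhoffMax T φ (n + 1) x - birkhoffMax T φ n (T x)) ∂μ)
        atTop (𝓝 (∫ x, φ x ∂μ)) := by
      refine tendsto_integral_of_dominated_convergence (fun x => |φ x| + |φ (T x)|) (fun n => ?_)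
        (hφ.abs.add (hTp.integrable_comp_of_integrable hφ).abs) (fun n => .of_forall fun x => ?_) ?_
      · exact ((measurable_birkhoffMax hTp.measurable hm _).sub
          ((measurable_birkhoffMax hTp.measurable hm _).comp hTp.measurable)).aestronglyMeasurable
      · have h1 := le_birkhoffMax (T := T) φ n (T x)
        simp only [birkhoffMax, Real.norm_eq_abs]
        have h2 := neg_abs_le (φ (T x))
        have h3 := abs_nonneg (φ (T x))
        have h4 := neg_abs_le (φ x)
        have h5 := le_abs_self (φ x)
        rcases max_cases 0 (birkhoffMax T φ n (T x)) with ⟨h, h'⟩ | ⟨h, h'⟩ <;> rw [h, abs_le] <;>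
          constructor <;> linarith
      · filter_upwards [h] with x hx
        have hx' : ¬ BddAbove (Set.range fun n => birkhoffMax T φ n (T x)) :=
          fun hb => hx ((bddAbove_birkhoffMax_comp_iff φ x).1 hb)
        have htop := tendsto_atTop_atTop_of_monotone'
          (monotone_nat_of_le_succ fun n => birkhoffMax_le_succ φ n (T x)) hx'
        refine tendsto_const_nhds.congr' ?_
        filter_upwards [htop.eventually_ge_atTop 0] with n hn
        simp [birkhoffMax, max_eq_right hn]
    -- By invariance of `μ` each integral is that of an increment of the monotone maxima, so the
    -- limit `∫ φ` would be nonnegative.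
    refine hneg.not_ge (ge_of_tendsto' hlim fun n => ?_)
    have hi := integrable_birkhoffMax hTp hφ
    have hsub : ∫ x, (birkhoffMax T φ (n + 1) x - birkhoffMax T φ n (T x)) ∂μ =
        ∫ x, birkhoffMax T φ (n + 1) x ∂μ - ∫ x, birkhoffMax T φ n (T x) ∂μ :=
      integral_sub (hi _) (hTp.integrable_comp_of_integrable (hi n))
    have hcomp : ∫ x, birkhoffMax T φ n (T x) ∂μ = ∫ x, birkhoffMax T φ n x ∂μ := by
      rw [← integral_map hTp.measurable.aemeasurable, hTp.map_eq]
      rw [hTp.map_eq]; exact (hi n).aestronglyMeasurable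
    rw [hsub, hcomp, sub_nonneg]
    exact integral_mono (hi _) (hi _) (birkhoffMax_le_succ φ n)

/-- For `d` strictly between the mean and `c`, the sums of `f - d` are bounded by some `C`; the
averages are then at most `d + C / n`. -/
theorem ae_birkhoffAverage_le [IsProbabilityMeasure μ] (hT : Ergodic T μ) {f : X → ℝ}
    (hm : Measurable f) (hf : Integrable f μ) {c : ℝ} (hc : ∫ x, f x ∂μ < c) :
    ∀ᵐ x ∂μ, ∀ᶠ n : ℕ in atTop, birkhoffAverage ℝ T f n x ≤ c := by
  obtain ⟨d, hd, hdc⟩ := exists_between hc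
  have := ae_bddAbove_birkhoffSum hT (hm.sub_const d) (hf.sub (integrable_const d)) (by
    rw [integral_sub hf (integrable_const d)]; simpa using hd)
  filter_upwards [this] with x ⟨C, hC⟩
  have hn : ∀ᶠ n : ℕ in atTop, C / (c - d) ≤ n :=
    tendsto_natCast_atTop_atTop.eventually_ge_atTop _
  filter_upwards [hn, eventually_gt_atTop 0] with n hn hpos
  have h1 := hC n
  have h2 : birkhoffSum T (fun x => f x - d) n x = birkhoffSum T f n x - n * d := by
    simp [birkhoffSum, Finset.sum_sub_distrib]
  rw [div_le_iff₀ (by linarith)] at hn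
  rw [h2] at h1
  rw [birkhoffAverage, smul_eq_mul, inv_mul_le_iff₀ (by exact_mod_cast hpos)]
  nlinarith

/-- Birkhoff's pointwise ergodic theorem for an ergodic map and a real function. -/
theorem ae_tendsto_birkhoffAverage_real [IsProbabilityMeasure μ] (hT : Ergodic T μ) {f : X → ℝ}
    (hm : Measurable f) (hf : Integrable f μ) :
    ∀ᵐ x ∂μ, Tendsto (fun n => birkhoffAverage ℝ T f n x) atTop (𝓝 (∫ x, f x ∂μ)) := by
  have hpos (m : ℕ) : (0 : ℝ) < 1 / (m + 1 : ℝ) := Nat.one_div_pos_of_nat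
  have h1 : ∀ᵐ x ∂μ, ∀ m : ℕ, ∀ᶠ n : ℕ in atTop,
      birkhoffAverage ℝ T f n x ≤ ∫ x, f x ∂μ + 1 / (m + 1 : ℝ) :=
    ae_all_iff.2 fun m => ae_birkhoffAverage_le hT hm hf (lt_add_of_pos_right _ (hpos m))
  have h2 : ∀ᵐ x ∂μ, ∀ m : ℕ, ∀ᶠ n : ℕ in atTop,
      birkhoffAverage ℝ T (-f) n x ≤ -∫ x, f x ∂μ + 1 / (m + 1 : ℝ) :=
    ae_all_iff.2 fun m => ae_birkhoffAverage_le hT hm.neg hf.neg (by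
      simp only [Pi.neg_apply, integral_neg]; exact lt_add_of_pos_right _ (hpos m))
  filter_upwards [h1, h2] with x h1 h2
  rw [Metric.tendsto_nhds]
  intro ε hε
  obtain ⟨m, hm⟩ := exists_nat_one_div_lt hε
  filter_upwards [h1 m, h2 m] with n h1 h2
  have h3 : birkhoffAverage ℝ T (-f) n x = -birkhoffAverage ℝ T f n x := by
    simp [birkhoffAverage, birkhoffSum]
  rw [Real.dist_eq, abs_lt]
  constructor <;> linarith

/-- Birkhoff's pointwise ergodic theorem for an ergodic map and a complex function. -/
theorem ae_tendsto_birkhoffAverage [IsProbabilityMeasure μ] (hT : Ergodic T μ) {f : X → ℂ}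
    (hm : Measurable f) (hf : Integrable f μ) :
    ∀ᵐ x ∂μ, Tendsto (fun n => birkhoffAverage ℂ T f n x) atTop (𝓝 (∫ x, f x ∂μ)) := by
  filter_upwards [ae_tendsto_birkhoffAverage_real hT (Complex.measurable_re.comp hm) hf.re,
    ae_tendsto_birkhoffAverage_real hT (Complex.measurable_im.comp hm) hf.im] with x h1 h2
  have h := ((Complex.continuous_ofReal.tendsto _).comp h1).add
    (((Complex.continuous_ofReal.tendsto _).comp h2).mul_const Complex.I)
  have hint := integral_re_add_im hf
  simp only [RCLike.re_to_complex, RCLike.im_to_complex, Complex.coe_algebraMap,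
    RCLike.I_to_complex] at hint
  refine (h.congr fun n => ?_).trans_eq ?_
  · simp only [Function.comp_apply, birkhoffAverage, birkhoffSum, smul_eq_mul]
    push_cast
    rw [mul_assoc, ← mul_add, Finset.sum_mul, ← Finset.sum_add_distrib]
    simp
  · rw [← hint]; rfl

end Birkhoff

/-! ### Elementary estimates for twisted averages -/

section Averages

variable {X : Type*} {T : X → X}

theorem norm_circle_zpow (ξ : Circle) (k : ℤ) : ‖(ξ : ℂ) ^ k‖ = 1 := by
  rw [norm_zpow, Circle.norm_coe, one_zpow]

theorem av_add (f g : X → ℂ) (ξ : Circle) (n : ℕ) (x : X) :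
    av T (f + g) ξ n x = av T f ξ n x + av T g ξ n x := by
  simp only [av, Pi.add_apply, mul_add, Finset.sum_add_distrib]

theorem av_smul (c : ℂ) (f : X → ℂ) (ξ : Circle) (n : ℕ) (x : X) :
    av T (c • f) ξ n x = c * av T f ξ n x := by
  simp only [av, Pi.smul_apply, smul_eq_mul, Finset.mul_sum]
  exact Finset.sum_congr rfl fun j _ => by ring

/-- Cauchy–Schwarz with weights of modulus one. At generic points the right side tends to the
squared `L²` norm. -/
theorem norm_av_sq_le (f : X → ℂ) (ξ : Circle) (n : ℕ) (x : X) :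
    ‖av T f ξ n x‖ ^ 2 ≤ 1 / (n : ℝ) * ∑ j ∈ Finset.range n, ‖f (T^[j] x)‖ ^ 2 := by
  rcases n.eq_zero_or_pos with rfl | hn
  · simp [av]
  have h1 : ‖av T f ξ n x‖ ≤ 1 / (n : ℝ) * ∑ j ∈ Finset.range n, ‖f (T^[j] x)‖ := by
    rw [av, norm_mul]
    simp only [one_div, norm_inv, RCLike.norm_natCast]
    gcongr
    refine (norm_sum_le _ _).trans (Finset.sum_le_sum fun j _ => ?_)
    rw [norm_mul, norm_circle_zpow, one_mul]
  have h2 : (∑ j ∈ Finset.range n, ‖f (T^[j] x)‖) ^ 2 ≤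
      n * ∑ j ∈ Finset.range n, ‖f (T^[j] x)‖ ^ 2 := by
    simpa using sq_sum_le_card_mul_sum_sq (s := Finset.range n) (f := fun j => ‖f (T^[j] x)‖)
  have hn' : (0 : ℝ) < n := by exact_mod_cast hn
  calc ‖av T f ξ n x‖ ^ 2 ≤ (1 / (n : ℝ) * ∑ j ∈ Finset.range n, ‖f (T^[j] x)‖) ^ 2 := by gcongr
    _ = (1 / (n : ℝ)) ^ 2 * (∑ j ∈ Finset.range n, ‖f (T^[j] x)‖) ^ 2 := mul_pow _ _ _
    _ ≤ (1 / (n : ℝ)) ^ 2 * (n * ∑ j ∈ Finset.range n, ‖f (T^[j] x)‖ ^ 2) := by gcongr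
    _ = _ := by field_simp

theorem norm_av_le {f : X → ℂ} {C : ℝ} (hC : 0 ≤ C) (hf : ∀ y, ‖f y‖ ≤ C) (ξ : Circle) (n : ℕ)
    (x : X) : ‖av T f ξ n x‖ ≤ C := by
  rcases n.eq_zero_or_pos with rfl | hn
  · simpa [av] using hC
  have hn' : (0 : ℝ) < n := by exact_mod_cast hn
  refine le_of_sq_le_sq ?_ hC
  refine (norm_av_sq_le f ξ n x).trans ?_
  calc 1 / (n : ℝ) * ∑ j ∈ Finset.range n, ‖f (T^[j] x)‖ ^ 2
      ≤ 1 / (n : ℝ) * ∑ j ∈ Finset.range n, C ^ 2 := by gcongr; exact hf _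
    _ = C ^ 2 := by simp; field_simp

/-- The difference telescopes to boundary terms; it makes limit functionals eigenvectors of the dual
operator. -/
theorem av_comp_sub (f : X → ℂ) (ξ : Circle) (n : ℕ) (x : X) :
    av T (f ∘ T) ξ n x - ξ * av T f ξ n x =
      (1 / (n : ℂ)) * (ξ * ((ξ : ℂ) ^ (-(n : ℤ)) * f (T^[n] x) - f x)) := by
  have hξ : (ξ : ℂ) ≠ 0 := Circle.coe_ne_zero ξ
  have h : ∑ j ∈ Finset.range n, (ξ : ℂ) ^ (-(j : ℤ)) * f (T (T^[j] x)) =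
      ξ * ∑ j ∈ Finset.range n, (ξ : ℂ) ^ (-((j + 1 : ℕ) : ℤ)) * f (T^[j + 1] x) := by
    rw [Finset.mul_sum]
    refine Finset.sum_congr rfl fun j _ => ?_
    rw [Function.iterate_succ_apply', ← mul_assoc]
    congr 1
    rw [← zpow_one_add₀ hξ]
    congr 1
    push_cast
    ring
  have h2 := Finset.sum_range_sub (fun j => (ξ : ℂ) ^ (-(j : ℤ)) * f (T^[j] x)) n
  rw [Finset.sum_sub_distrib] at h2
  simp only [av, Function.comp_apply]
  rw [h]
  simp only [Nat.cast_zero, neg_zero, zpow_zero, one_mul, Function.iterate_zero, id] at h2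
  rw [← h2]
  ring

theorem tendsto_av_comp_sub {f : X → ℂ} {C : ℝ} (hf : ∀ y, ‖f y‖ ≤ C) (ξ : Circle)
    (x : X) : Tendsto (fun n => av T (f ∘ T) ξ n x - ξ * av T f ξ n x) atTop (𝓝 0) := by
  simp only [av_comp_sub]
  refine squeeze_zero_norm (a := fun n : ℕ => 1 / (n : ℝ) * (C + C)) (fun n => ?_) ?_
  · rw [norm_mul, norm_mul]
    simp only [one_div, norm_inv, RCLike.norm_natCast, Circle.norm_coe, one_mul]
    gcongr
    refine (norm_sub_le _ _).trans (add_le_add ?_ (hf x))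
    rw [norm_mul, norm_circle_zpow, one_mul]
    exact hf _
  · simpa using tendsto_one_div_atTop_nhds_zero_nat.mul_const (C + C)

end Averages

/-! ### Limit functionals on `L²` at generic points -/

section Functional

theorem koopman_apply_ae {X : Type*} [MeasurableSpace X] {μ : Measure X} {T : X → X}
    (hT : MeasurePreserving T μ μ) (v : Lp ℂ 2 μ) :
    koopman hT v =ᵐ[μ] v ∘ T :=
  Lp.coeFn_compMeasurePreserving v hT


variable {X : Type*} [MetricSpace X] [CompactSpace X] [MeasurableSpace X] [BorelSpace X]
  {μ : Measure X} {T : X → X} {x : X} {ξ : Circle}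

theorem koopman_toLp [IsFiniteMeasure μ] (hT : MeasurePreserving T μ μ) (hc : Continuous T)
    (f : C(X, ℂ)) :
    koopman hT (f.toLp 2 μ ℂ) = (f.comp ⟨T, hc⟩).toLp 2 μ ℂ := by
  refine Lp.ext ?_
  filter_upwards [koopman_apply_ae hT (f.toLp 2 μ ℂ), (f.comp ⟨T, hc⟩).coeFn_toLp (p := 2) μ (𝕜 := ℂ),
    hT.quasiMeasurePreserving.ae (f.coeFn_toLp (p := 2) μ (𝕜 := ℂ))] with y h1 h2 h3
  rw [h1, h2, Function.comp_apply, h3]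
  rfl

theorem denseRange_toLp [IsFiniteMeasure μ] :
    DenseRange (ContinuousMap.toLp 2 μ ℂ : C(X, ℂ) →L[ℂ] Lp ℂ 2 μ) :=
  ContinuousMap.toLp_denseRange ℂ μ ℂ (by simp)

theorem tendsto_sum_norm_sq [IsFiniteMeasure μ] (hx : IsGeneric T μ x) (f : C(X, ℂ)) :
    Tendsto (fun n : ℕ => 1 / (n : ℝ) * ∑ j ∈ Finset.range n, ‖f (T^[j] x)‖ ^ 2) atTop
      (𝓝 (‖f.toLp 2 μ ℂ‖ ^ 2)) := by
  have h := hx (f * star f)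
  have hin := ContinuousMap.inner_toLp μ (𝕜 := ℂ) f f
  rw [inner_self_eq_norm_sq_to_K] at hin
  have h2 : ∫ y, (f * star f) y ∂μ = ((‖f.toLp 2 μ ℂ‖ ^ 2 : ℝ) : ℂ) := by
    push_cast
    exact hin.symm
  rw [h2] at h
  refine ((Complex.continuous_re.tendsto _).comp h).congr fun n => ?_
  have : (1 / (n : ℂ)) * ∑ j ∈ Finset.range n, (f * star f) (T^[j] x) =
      ((1 / (n : ℝ) * ∑ j ∈ Finset.range n, ‖f (T^[j] x)‖ ^ 2 : ℝ) : ℂ) := by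
    push_cast
    congr 1
    refine Finset.sum_congr rfl fun j _ => ?_
    simpa using Complex.mul_conj' (f (T^[j] x))
  rw [Function.comp_apply, this, Complex.ofReal_re]

/-- At a generic point, any limit of the twisted averages along a filter extends to a bounded
functional on `L²` which is an eigenvector of the dual Koopman operator. -/
theorem exists_functional_of_tendsto [IsFiniteMeasure μ] (hT : MeasurePreserving T μ μ)
    (hc : Continuous T) (hx : IsGeneric T μ x) {F : Filter ℕ} [F.NeBot] (hF : F ≤ atTop)
    (hconv : ∀ f : C(X, ℂ), ∃ l, Tendsto (fun n => av T f ξ n x) F (𝓝 l)) :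
    ∃ a : Lp ℂ 2 μ →L[ℂ] ℂ,
      (∀ f : C(X, ℂ), Tendsto (fun n => av T f ξ n x) F (𝓝 (a (f.toLp 2 μ ℂ)))) ∧
      ∀ v, a (koopman hT v) = ξ * a v := by
  choose l hl using hconv
  let L : C(X, ℂ) →ₗ[ℂ] ℂ :=
    { toFun := l
      map_add' := fun f g => tendsto_nhds_unique (hl (f + g))
        (((hl f).add (hl g)).congr fun n => (av_add f g ξ n x).symm)
      map_smul' := fun c f => tendsto_nhds_unique (hl (c • f))
        (((hl f).const_mul c).congr fun n => (av_smul c f ξ n x).symm) }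
  let e : C(X, ℂ) →ₗ[ℂ] Lp ℂ 2 μ := (ContinuousMap.toLp 2 μ ℂ : C(X, ℂ) →L[ℂ] Lp ℂ 2 μ)
  have hbound (f : C(X, ℂ)) : ‖L f‖ ≤ 1 * ‖e f‖ := by
    rw [one_mul]
    refine le_of_sq_le_sq ?_ (norm_nonneg _)
    exact le_of_tendsto_of_tendsto' ((hl f).norm.pow 2) ((tendsto_sum_norm_sq hx f).mono_left hF)
      fun n => norm_av_sq_le f ξ n x
  have hd : DenseRange e := denseRange_toLp
  have ha (f : C(X, ℂ)) : L.extendOfNorm e (f.toLp 2 μ ℂ) = l f :=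
    LinearMap.extendOfNorm_eq hd ⟨1, hbound⟩ f
  refine ⟨L.extendOfNorm e, fun f => ?_, fun v => ?_⟩
  · rw [ha]; exact hl f
  · refine isClosed_property
      (p := fun v => L.extendOfNorm e (koopman hT v) = ξ * L.extendOfNorm e v)
      (denseRange_toLp (μ := μ) (X := X)) (isClosed_eq (by fun_prop) (by fun_prop)) (fun f => ?_) v
    rw [koopman_toLp hT hc, ha, ha, ← sub_eq_zero]
    have h0 := (tendsto_av_comp_sub (T := T) (fun y => f.norm_coe_le_norm y) ξ x).mono_left hF
    have h1 : Tendsto (fun n => av T (f ∘ T) ξ n x) F (𝓝 (l (f.comp ⟨T, hc⟩))) :=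
      hl (f.comp ⟨T, hc⟩)
    exact tendsto_nhds_unique (h1.sub ((hl f).const_mul (ξ : ℂ))) h0

end Functional

/-! ### A regular point forces ergodicity -/

section Ergodicity

theorem tendsto_av_one_iff {X : Type*} {T : X → X} {x : X} {f : X → ℂ} {l : ℂ} :
    Tendsto (fun n => av T f 1 n x) atTop (𝓝 l) ↔
      Tendsto (fun n : ℕ => (1 / (n : ℂ)) * ∑ j ∈ Finset.range n, f (T^[j] x)) atTop (𝓝 l) := by
  simp [av]

theorem mem_kronecker_of_eq {X : Type*} [MeasurableSpace X] {μ : Measure X} {T : X → X}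
    (hT : MeasurePreserving T μ μ) {h : Lp ℂ 2 μ} {c : ℂ}
    (hh : koopman hT h = c • h) : h ∈ kronecker hT := by
  rcases eq_or_ne h 0 with rfl | h0
  · exact zero_mem _
  · refine Submodule.le_topologicalClosure _ (Submodule.subset_span ⟨c, ?_⟩)
    exact Module.End.hasEigenvector_iff.2 ⟨Module.End.mem_eigenspace_iff.2 hh, h0⟩

variable {X : Type*} [MetricSpace X] [CompactSpace X] [MeasurableSpace X] [BorelSpace X]
  {μ : Measure X} {T : X → X} {x : X}

/-- At a regular Wiener-Wintner generic point, an invariant `L²` function orthogonal to the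
constants vanishes. -/
theorem IsRegularWWGeneric.eq_zero_of_koopman_eq [IsFiniteMeasure μ] {hT : MeasurePreserving T μ μ}
    (hx : IsRegularWWGeneric hT x) (hc : Continuous T) {h : Lp ℂ 2 μ} (hh : koopman hT h = h)
    (h1 : inner ℂ ((1 : C(X, ℂ)).toLp 2 μ ℂ) h = 0) : h = 0 := by
  obtain ⟨⟨hgen, hww⟩, hreg⟩ := hx
  choose a ha hUa using fun ξ =>
    exists_functional_of_tendsto (ξ := ξ) hT hc hgen le_rfl (fun f => hww f ξ)
  have ha1 (v : Lp ℂ 2 μ) : a 1 v = inner ℂ ((1 : C(X, ℂ)).toLp 2 μ ℂ) v := by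
    refine isClosed_property (p := fun v => a 1 v = inner ℂ ((1 : C(X, ℂ)).toLp 2 μ ℂ) v)
      (denseRange_toLp (μ := μ) (X := X)) (isClosed_eq (by fun_prop) (by fun_prop)) (fun f => ?_) v
    rw [ContinuousMap.inner_toLp]
    refine tendsto_nhds_unique (tendsto_av_one_iff.1 (ha 1 f)) ?_
    simpa using hgen f
  have hah (ξ : Circle) : a ξ h = 0 := by
    by_cases hξ : ξ = 1
    · rw [hξ, ha1, h1]
    · have h2 := hUa ξ h
      rw [hh] at h2
      have h3 : (1 - (ξ : ℂ)) * a ξ h = 0 := by linear_combination h2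
      refine (mul_eq_zero.1 h3).resolve_left fun h4 => hξ ?_
      exact Circle.ext (by rw [Circle.coe_one]; linear_combination -h4)
  set P := (kronecker hT).starProjection
  have hsum (f : C(X, ℂ)) : HasSum (fun ξ : Freq T x => ‖a ξ (f.toLp 2 μ ℂ)‖ ^ 2)
      (‖P (f.toLp 2 μ ℂ)‖ ^ 2) := by
    have h2 := hreg f
    have h3 (ξ : Circle) : avLim T f ξ x = a ξ (f.toLp 2 μ ℂ) := (ha ξ f).limUnder_eq
    simpa only [h3] using h2
  have hbessel (s : Finset (Freq T x)) (v : Lp ℂ 2 μ) : ∑ ξ ∈ s, ‖a ξ v‖ ^ 2 ≤ ‖v‖ ^ 2 := by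
    refine isClosed_property (p := fun v => ∑ ξ ∈ s, ‖a ξ v‖ ^ 2 ≤ ‖v‖ ^ 2)
      (denseRange_toLp (μ := μ) (X := X)) (isClosed_le (by fun_prop) (by fun_prop)) (fun f => ?_) v
    refine (sum_le_hasSum s (fun _ _ => by positivity) (hsum f)).trans ?_
    gcongr
    exact Submodule.norm_starProjection_apply_le _ _
  -- For continuous `f` the sum giving `‖P f‖²` is unchanged by replacing `f` with `f - h`, where
  -- Bessel applies. Density then allows `v = h`.
  have hP (v : Lp ℂ 2 μ) : ‖P v‖ ^ 2 ≤ ‖v - h‖ ^ 2 := by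
    refine isClosed_property (p := fun v => ‖P v‖ ^ 2 ≤ ‖v - h‖ ^ 2)
      (denseRange_toLp (μ := μ) (X := X)) (isClosed_le (by fun_prop) (by fun_prop)) (fun f => ?_) v
    refine hasSum_le_of_sum_le (hsum f) fun s => ?_
    simpa [hah] using hbessel s (f.toLp 2 μ ℂ - h)
  have hK : h ∈ kronecker hT := mem_kronecker_of_eq hT (c := 1) (by simpa using hh)
  have hPh : P h = h := Submodule.starProjection_eq_self_iff.2 hK
  have := hP h
  rw [hPh] at this
  simpa using this

theorem IsRegularWWGeneric.ergodic [IsProbabilityMeasure μ] {hT : MeasurePreserving T μ μ}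
    (hx : IsRegularWWGeneric hT x) (hc : Continuous T) : Ergodic T μ := by
  refine ⟨hT, ⟨fun s hs hinv => ?_⟩⟩
  set u : Lp ℂ 2 μ := (1 : C(X, ℂ)).toLp 2 μ ℂ with hu
  have huae : u =ᵐ[μ] fun _ => 1 := by
    filter_upwards [(1 : C(X, ℂ)).coeFn_toLp (p := 2) μ (𝕜 := ℂ)] with y hy
    rw [hu, hy]; rfl
  have huu : inner ℂ u u = 1 := by
    rw [hu, ContinuousMap.inner_toLp]; simp
  have hUu : koopman hT u = u := by
    rw [hu, koopman_toLp hT hc]; rfl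
  set w : Lp ℂ 2 μ := indicatorConstLp 2 hs (measure_ne_top μ s) 1 with hw
  have hUw : koopman hT w = w := by
    -- Generalizing the set lets `T ⁻¹' s` be replaced by `s` despite the dependent measurability
    -- proof.
    have key : ∀ (s' : Set X) (hs' : MeasurableSet s'), s' = s →
        indicatorConstLp 2 hs' (measure_ne_top μ s') (1 : ℂ) = w := by rintro _ _ rfl; rfl
    exact (Lp.indicatorConstLp_compMeasurePreserving (p := 2) hs (measure_ne_top μ s) (1 : ℂ) hT).trans
      (key _ (hs.preimage hT.measurable) hinv)
  have hz := hx.eq_zero_of_koopman_eq hc (h := w - inner ℂ u w • u)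
    (by rw [map_sub, map_smul, hUw, hUu]) (by rw [← hu, inner_sub_right, inner_smul_right, huu, mul_one, sub_self])
  have hwu : w = inner ℂ u w • u := sub_eq_zero.1 hz
  have hconst : ∀ᵐ y ∂μ, s.indicator (fun _ => (1 : ℂ)) y = inner ℂ u w := by
    have h1 : (w : X → ℂ) =ᵐ[μ] inner ℂ u w • (u : X → ℂ) := by
      have := Lp.coeFn_smul (inner ℂ u w) u
      rw [← hwu] at this
      exact this
    filter_upwards [h1, huae, indicatorConstLp_coeFn (p := 2) (hs := hs)
      (hμs := measure_ne_top μ s) (c := (1 : ℂ))] with y h1 h2 h3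
    rw [← h3, ← hw, h1, Pi.smul_apply, h2, smul_eq_mul, mul_one]
  rw [eventuallyConst_set]
  by_cases hcase : inner ℂ u w = (0 : ℂ)
  · right
    filter_upwards [hconst] with y hy h
    rw [hcase, Set.indicator_of_mem h] at hy
    exact one_ne_zero hy
  · left
    filter_upwards [hconst] with y hy
    by_contra h
    rw [Set.indicator_of_notMem h] at hy
    exact hcase hy.symm

end Ergodicity

/-! ### Eigenvalues, and convergence at generic points -/

/-- The set of eigenvalues of the Koopman operator, as a subset of the circle. -/
def eigenvalueSet {X : Type*} [MeasurableSpace X] {μ : Measure X} {T : X → X}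
    (hT : MeasurePreserving T μ μ) : Set Circle :=
  {ξ | ∃ v : Lp ℂ 2 μ, v ≠ 0 ∧ koopman hT v = (ξ : ℂ) • v}

/-- Expanding `‖U g - ξ g‖²` gives zero because `U` is isometric; invertibility of `U` is not
needed. -/
theorem koopman_eq_smul_of_inner {X : Type*} [MeasurableSpace X] {μ : Measure X} {T : X → X}
    (hT : MeasurePreserving T μ μ) {g : Lp ℂ 2 μ} {ξ : Circle}
    (h : ∀ v, inner ℂ g (koopman hT v) = ξ * inner ℂ g v) : koopman hT g = (ξ : ℂ) • g := by
  rw [← sub_eq_zero, ← inner_self_eq_zero (𝕜 := ℂ)]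
  have h1 : inner ℂ (koopman hT g) g = (starRingEnd ℂ) (ξ * inner ℂ g g) := by
    rw [← h, inner_conj_symm]
  have h2 : (ξ : ℂ) * (starRingEnd ℂ) (ξ : ℂ) = 1 := by
    rw [Complex.mul_conj, Circle.normSq_coe, Complex.ofReal_one]
  have h3 : (starRingEnd ℂ) (inner ℂ g g) = inner ℂ g g := inner_conj_symm g g
  rw [inner_sub_left, inner_sub_right, inner_sub_right, inner_smul_left, inner_smul_left,
    inner_smul_right, inner_smul_right, LinearIsometry.inner_map_map, h, h1, map_mul, h3]
  linear_combination (-(inner ℂ g g : ℂ)) * h2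

section Convergence

/-- Convergence of the twisted averages at a point passes from a dense set of continuous functions
to all of them. -/
theorem tendsto_av_of_dense {X : Type*} [MetricSpace X] [CompactSpace X] {T : X → X} {x : X}
    {ξ : Circle} {D : Set C(X, ℂ)} (hD : Dense D) (a : C(X, ℂ) →L[ℂ] ℂ)
    (h : ∀ f ∈ D, Tendsto (fun n => av T f ξ n x) atTop (𝓝 (a f))) (f : C(X, ℂ)) :
    Tendsto (fun n => av T f ξ n x) atTop (𝓝 (a f)) := by
  rw [Metric.tendsto_nhds]
  intro ε hε
  have hpos : 0 < ε / (2 * (‖a‖ + 2)) := by positivity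
  obtain ⟨g, hgD, hg⟩ := Metric.dense_iff.1 hD f _ hpos
  rw [Metric.mem_ball, dist_comm, dist_eq_norm] at hgD
  filter_upwards [Metric.tendsto_nhds.1 (h g hg) (ε / 2) (by positivity)] with n hn
  rw [dist_eq_norm] at hn ⊢
  have h1 : av T f ξ n x = av T (f - g : C(X, ℂ)) ξ n x + av T g ξ n x := by
    rw [← av_add]
    congr 1
    ext y
    simp
  have h2 : a f = a (f - g) + a g := by rw [← map_add, sub_add_cancel]
  have h3 := norm_av_le (T := T) (norm_nonneg (f - g)) (f - g).norm_coe_le_norm ξ n x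
  have h4 := a.le_opNorm (f - g)
  have h5 : ‖f - g‖ * (2 * (‖a‖ + 2)) < ε := (lt_div_iff₀ (by positivity)).1 hgD
  rw [h1, h2]
  calc _ = ‖av T (f - g : C(X, ℂ)) ξ n x - a (f - g) + (av T g ξ n x - a g)‖ := by
        congr 1; ring
    _ ≤ ‖av T (f - g : C(X, ℂ)) ξ n x‖ + ‖a (f - g)‖ + ‖av T g ξ n x - a g‖ :=
        (norm_add_le _ _).trans (add_le_add_left (norm_sub_le _ _) _)
    _ < ε := by nlinarith [norm_nonneg (f - g)]

variable {X : Type*} [MetricSpace X] [CompactSpace X] [MeasurableSpace X] [BorelSpace X]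
  {μ : Measure X} {T : X → X} {x : X} {ξ : Circle}

/-- At every generic point, the twisted averages at a frequency which is not an eigenvalue tend
to zero. -/
theorem IsGeneric.tendsto_av_zero [IsFiniteMeasure μ] (hx : IsGeneric T μ x)
    (hT : MeasurePreserving T μ μ) (hc : Continuous T) (hξ : ξ ∉ eigenvalueSet hT) (f : C(X, ℂ)) :
    Tendsto (fun n => av T f ξ n x) atTop (𝓝 0) := by
  -- Along an ultrafilter the bounded averages of all `f` converge simultaneously, so a limit
  -- functional exists before convergence is known.
  rw [tendsto_iff_ultrafilter]
  intro U hU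
  obtain ⟨a, ha, hUa⟩ := exists_functional_of_tendsto (ξ := ξ) hT hc hx hU fun f => by
    obtain ⟨l, -, hl⟩ := (isCompact_closedBall (0 : ℂ) ‖f‖).ultrafilter_le_nhds
      (U.map fun n => av T f ξ n x) (by
        rw [Ultrafilter.coe_map, le_principal_iff]
        refine Filter.mem_map.2 (Filter.univ_mem' fun n => ?_)
        rw [Set.mem_preimage, mem_closedBall_zero_iff]
        exact norm_av_le (norm_nonneg f) f.norm_coe_le_norm ξ n x)
    exact ⟨l, hl⟩
  have ha0 : a = 0 := by
    by_contra hne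
    set g := (InnerProductSpace.toDual ℂ (Lp ℂ 2 μ)).symm a with hg
    have hin (v : Lp ℂ 2 μ) : inner ℂ g v = a v := InnerProductSpace.toDual_symm_apply
    refine hξ ⟨g, ?_, koopman_eq_smul_of_inner hT fun v => by rw [hin, hin, hUa]⟩
    rw [hg]
    exact fun h => hne ((LinearIsometryEquiv.map_eq_zero_iff _).1 h)
  simpa [ha0] using ha f

/-- For an ergodic measure, almost every point is generic. -/
theorem ae_isGeneric [IsProbabilityMeasure μ] (hT : Ergodic T μ) :
    ∀ᵐ x ∂μ, IsGeneric T μ x := by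
  obtain ⟨D, hDc, hD⟩ := TopologicalSpace.exists_countable_dense C(X, ℂ)
  have key : ∀ᵐ x ∂μ, ∀ f ∈ D, Tendsto (fun n => birkhoffAverage ℂ T f n x) atTop
      (𝓝 (∫ y, f y ∂μ)) :=
    (ae_ball_iff hDc).2 fun f _ => ae_tendsto_birkhoffAverage hT f.continuous.measurable
      (f.continuous.integrable_of_hasCompactSupport (HasCompactSupport.of_compactSpace f))
  filter_upwards [key] with x hx f
  let a : C(X, ℂ) →L[ℂ] ℂ := (innerSL ℂ ((1 : C(X, ℂ)).toLp 2 μ ℂ)).comp (ContinuousMap.toLp 2 μ ℂ)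
  have ha (f : C(X, ℂ)) : a f = ∫ y, f y ∂μ := by
    refine (ContinuousMap.inner_toLp μ (𝕜 := ℂ) 1 f).trans ?_
    simp
  rw [← ha]
  refine tendsto_av_one_iff.1 (tendsto_av_of_dense hD a (fun f hf => tendsto_av_one_iff.2 ?_) f)
  rw [ha]
  simpa [birkhoffAverage, birkhoffSum] using hx f hf

end Convergence

/-! ### Eigenfunctions of ergodic systems -/

section Eigenfunctions

variable {X : Type*} [MeasurableSpace X] {μ : Measure X} {T : X → X}

theorem exists_circle_of_koopman_eq_smul {hT : MeasurePreserving T μ μ} {v : Lp ℂ 2 μ} (hv : v ≠ 0)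
    {c : ℂ} (h : koopman hT v = c • v) : ∃ ξ : Circle, c = ξ := by
  have h1 := (koopman hT).norm_map v
  rw [h, norm_smul] at h1
  have h2 : ‖c‖ = 1 := by
    have := norm_ne_zero_iff.2 hv
    exact mul_right_cancel₀ this (by rw [h1, one_mul])
  exact ⟨⟨c, mem_sphere_zero_iff_norm.2 h2⟩, rfl⟩

theorem ae_comp_eq_of_koopman_eq_smul {hT : MeasurePreserving T μ μ} {v : Lp ℂ 2 μ} {c : ℂ}
    (h : koopman hT v = c • v) : ∀ᵐ y ∂μ, v (T y) = c * v y := by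
  have h1 := koopman_apply_ae hT v
  rw [h] at h1
  filter_upwards [h1, Lp.coeFn_smul c v] with y h1 h2
  rw [← Function.comp_apply (f := v) (g := T), ← h1, h2]
  rfl

theorem inner_eq_zero_of_koopman_eq_smul {hT : MeasurePreserving T μ μ} {v w : Lp ℂ 2 μ}
    {ξ η : Circle} (hv : koopman hT v = (ξ : ℂ) • v) (hw : koopman hT w = (η : ℂ) • w)
    (hne : ξ ≠ η) : inner ℂ v w = (0 : ℂ) := by
  have h := (koopman hT).inner_map_map v w
  rw [hv, hw, inner_smul_left, inner_smul_right] at h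
  have h2 : (ξ : ℂ) * (starRingEnd ℂ) (ξ : ℂ) = 1 := by
    rw [Complex.mul_conj, Circle.normSq_coe, Complex.ofReal_one]
  have h3 : ((ξ : ℂ) - η) * inner ℂ v w = 0 := by
    linear_combination (-(ξ : ℂ)) * h + (η : ℂ) * inner ℂ v w * h2
  exact (mul_eq_zero.1 h3).resolve_left fun h4 => hne (Circle.ext (sub_eq_zero.1 h4))

theorem norm_sq_eq_integral (v : Lp ℂ 2 μ) : ((‖v‖ ^ 2 : ℝ) : ℂ) = ∫ y, ((‖v y‖ ^ 2 : ℝ) : ℂ) ∂μ := by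
  have h := L2.inner_def (𝕜 := ℂ) v v
  rw [inner_self_eq_norm_sq_to_K] at h
  push_cast
  refine Eq.trans (by norm_cast) (h.trans (integral_congr_ae (.of_forall fun y => ?_)))
  simp [inner_self_eq_norm_sq_to_K]

/-- A normalized eigenfunction of an ergodic system has modulus one almost everywhere. -/
theorem ae_norm_eq_one [IsProbabilityMeasure μ] (hE : Ergodic T μ) {hT : MeasurePreserving T μ μ}
    {v : Lp ℂ 2 μ} {ξ : Circle} (hv : koopman hT v = (ξ : ℂ) • v) (h1 : ‖v‖ = 1) :
    ∀ᵐ y ∂μ, ‖v y‖ = 1 := by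
  obtain ⟨c, hc⟩ := hE.ae_eq_const_of_ae_eq_comp_ae (g := fun y => ‖v y‖)
    (Lp.aestronglyMeasurable v).norm (by
      filter_upwards [ae_comp_eq_of_koopman_eq_smul hv] with y hy
      simp only [Function.comp_apply]
      rw [hy, norm_mul, Circle.norm_coe, one_mul])
  have h2 := norm_sq_eq_integral v
  have h3 : ∫ y, ((‖v y‖ ^ 2 : ℝ) : ℂ) ∂μ = ((c ^ 2 : ℝ) : ℂ) := by
    rw [integral_congr_ae (g := fun _ => ((c ^ 2 : ℝ) : ℂ))]
    · simp
    · filter_upwards [hc] with y hy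
      rw [hy]; rfl
  rw [h3, h1, Complex.ofReal_inj, one_pow] at h2
  have hc0 : 0 ≤ c := by
    obtain ⟨y, hy⟩ := hc.exists
    simp only [Function.const_apply] at hy
    rw [← hy]; exact norm_nonneg _
  have hc1 : c = 1 := by nlinarith
  filter_upwards [hc] with y hy
  rw [hy, hc1]; rfl

/-- The eigenspaces of an ergodic system are one-dimensional. -/
theorem exists_eq_smul_of_koopman_eq_smul [IsProbabilityMeasure μ] (hE : Ergodic T μ)
    {hT : MeasurePreserving T μ μ} {v w : Lp ℂ 2 μ} {ξ : Circle}
    (hv : koopman hT v = (ξ : ℂ) • v) (h1 : ‖v‖ = 1) (hw : koopman hT w = (ξ : ℂ) • w) :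
    ∃ c : ℂ, w = c • v := by
  have h2 : (ξ : ℂ) * (starRingEnd ℂ) (ξ : ℂ) = 1 := by
    rw [Complex.mul_conj, Circle.normSq_coe, Complex.ofReal_one]
  -- The factors `ξ` and `conj ξ` cancel, so `w · conj v` is invariant and hence constant.
  obtain ⟨c, hc⟩ := hE.ae_eq_const_of_ae_eq_comp_ae (g := fun y => w y * (starRingEnd ℂ) (v y))
    ((Lp.aestronglyMeasurable w).mul
      (Complex.continuous_conj.comp_aestronglyMeasurable (Lp.aestronglyMeasurable v))) (by
      filter_upwards [ae_comp_eq_of_koopman_eq_smul hv, ae_comp_eq_of_koopman_eq_smul hw]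
        with y hy hy'
      simp only [Function.comp_apply]
      rw [hy, hy', map_mul]
      linear_combination w y * (starRingEnd ℂ) (v y) * h2)
  refine ⟨c, Lp.ext ?_⟩
  filter_upwards [hc, ae_norm_eq_one hE hv h1, Lp.coeFn_smul c v] with y h3 h4 h5
  simp only [Function.const_apply] at h3
  have h6 : (starRingEnd ℂ) (v y) * v y = 1 := by
    rw [Complex.conj_mul', h4]; simp
  rw [h5, Pi.smul_apply, smul_eq_mul, ← h3]
  linear_combination -(w y) * h6

/-- For an ergodic system, normalized eigenfunctions form a Hilbert basis of the Kronecker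
factor. -/
theorem exists_eigenbasis [IsProbabilityMeasure μ] (hE : Ergodic T μ)
    (hT : MeasurePreserving T μ μ) :
    ∃ e : eigenvalueSet hT → Lp ℂ 2 μ, Orthonormal ℂ e ∧
      (∀ ξ, koopman hT (e ξ) = ((ξ : Circle) : ℂ) • e ξ) ∧
      ∀ f, HasSum (fun ξ => ‖(inner ℂ (e ξ) f : ℂ)‖ ^ 2)
        (‖(kronecker hT).starProjection f‖ ^ 2) := by
  have hex (ξ : eigenvalueSet hT) :
      ∃ v : Lp ℂ 2 μ, ‖v‖ = 1 ∧ koopman hT v = ((ξ : Circle) : ℂ) • v := by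
    obtain ⟨v, hv, h⟩ := ξ.2
    refine ⟨((‖v‖ : ℂ)⁻¹) • v, norm_smul_inv_norm hv, ?_⟩
    rw [map_smul, h, smul_comm]
  choose e he hUe using hex
  have hon : Orthonormal ℂ e :=
    ⟨he, fun ξ η hne => inner_eq_zero_of_koopman_eq_smul (hUe ξ) (hUe η)
      fun h => hne (Subtype.ext h)⟩
  refine ⟨e, hon, hUe, fun f => ?_⟩
  let e' : eigenvalueSet hT → kronecker hT := fun ξ => ⟨e ξ, mem_kronecker_of_eq hT (hUe ξ)⟩
  have hon' : Orthonormal ℂ e' :=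
    ⟨fun ξ => he ξ, fun ξ η hne => hon.2 hne⟩
  have hbot : (Submodule.span ℂ (Set.range e'))ᗮ = ⊥ := by
    rw [Submodule.eq_bot_iff]
    intro w hw
    have hw' (ξ : eigenvalueSet hT) : inner ℂ (e ξ) (w : Lp ℂ 2 μ) = (0 : ℂ) :=
      hw (e' ξ) (Submodule.subset_span ⟨ξ, rfl⟩)
    -- Every eigenfunction is a multiple of some `e ξ`, so the whole closed span, including `w`
    -- itself, is orthogonal to `w`.
    have hle : kronecker hT ≤ (ℂ ∙ (w : Lp ℂ 2 μ))ᗮ := by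
      refine Submodule.topologicalClosure_minimal _ (Submodule.span_le.2 ?_)
        (Submodule.isClosed_orthogonal _)
      rintro g ⟨c, hg⟩
      obtain ⟨hg1, hg0⟩ := Module.End.hasEigenvector_iff.1 hg
      have hg2 : koopman hT g = c • g := Module.End.mem_eigenspace_iff.1 hg1
      obtain ⟨ξ, rfl⟩ := exists_circle_of_koopman_eq_smul hg0 hg2
      have hξ : ξ ∈ eigenvalueSet hT := ⟨g, hg0, hg2⟩
      obtain ⟨d, rfl⟩ := exists_eq_smul_of_koopman_eq_smul hE (hUe ⟨ξ, hξ⟩) (he ⟨ξ, hξ⟩) hg2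
      rw [SetLike.mem_coe, Submodule.mem_orthogonal_singleton_iff_inner_left, inner_smul_left,
        hw', mul_zero]
    have := Submodule.mem_orthogonal_singleton_iff_inner_left.1 (hle w.2)
    exact Subtype.ext (inner_self_eq_zero.1 this)
  let b := HilbertBasis.mkOfOrthogonalEqBot hon' hbot
  let Pf : kronecker hT := (kronecker hT).orthogonalProjectionOnto f
  have hsum := lp.hasSum_norm (p := 2) (by simp) (b.repr Pf)
  have hterm (ξ : eigenvalueSet hT) : b.repr Pf ξ = inner ℂ (e ξ) f := by
    rw [b.repr_apply_apply, HilbertBasis.coe_mkOfOrthogonalEqBot]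
    exact Submodule.inner_orthogonalProjectionOnto_eq_of_mem_left (e' ξ) f
  have hPf : ‖Pf‖ = ‖(kronecker hT).starProjection f‖ := rfl
  simp only [hterm, LinearIsometryEquiv.norm_map, hPf] at hsum
  simpa using hsum

/-- Orthonormal vectors lie at distance `√2`, so their balls of radius `1/2` are disjoint.
Countability lets the null sets of all eigenvalues be united. -/
theorem countable_of_orthonormal {ι E : Type*} [NormedAddCommGroup E] [InnerProductSpace ℂ E]
    [TopologicalSpace.SeparableSpace E] {e : ι → E} (he : Orthonormal ℂ e) : Countable ι := by
  rw [← Set.countable_univ_iff]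
  refine Set.PairwiseDisjoint.countable_of_isOpen (s := fun i => Metric.ball (e i) (1 / 2))
    (fun i _ j _ hij => ?_) (fun i _ => Metric.isOpen_ball) (fun i _ => ⟨e i, by simp⟩)
  refine Metric.ball_disjoint_ball ?_
  have h : ‖e i - e j‖ ^ 2 = 2 := by
    rw [@norm_sub_sq ℂ, he.1, he.1, he.2 hij]; norm_num
  rw [dist_eq_norm]
  nlinarith [norm_nonneg (e i - e j)]

end Eigenfunctions

/-! ### Regularity of almost every point -/

section Regular

variable {X : Type*} [MetricSpace X] [CompactSpace X] [MeasurableSpace X] [BorelSpace X]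
  {μ : Measure X} {T : X → X}

/-- At almost every point, the twisted averages of all continuous functions at an eigenvalue
converge, the limit being the projection to the eigenspace evaluated at the point. -/
theorem ae_tendsto_av_eigenvalue [IsProbabilityMeasure μ] (hE : Ergodic T μ)
    {hT : MeasurePreserving T μ μ} {v : Lp ℂ 2 μ} {ξ : Circle} (hv : koopman hT v = (ξ : ℂ) • v)
    (h1 : ‖v‖ = 1) :
    ∀ᵐ x ∂μ, ∃ c : ℂ, ‖c‖ = 1 ∧ ∀ f : C(X, ℂ),
      Tendsto (fun n => av T f ξ n x) atTop (𝓝 (c * inner ℂ v (f.toLp 2 μ ℂ))) := by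
  obtain ⟨D, hDc, hD⟩ := TopologicalSpace.exists_countable_dense C(X, ℂ)
  have hint (f : C(X, ℂ)) : Integrable (fun y => f y * (starRingEnd ℂ) (v y)) μ ∧
      ∫ y, f y * (starRingEnd ℂ) (v y) ∂μ = inner ℂ v (f.toLp 2 μ ℂ) := by
    have hae : (fun y => f y * (starRingEnd ℂ) (v y)) =ᵐ[μ]
        fun y => inner ℂ (v y) (f.toLp 2 μ ℂ y) := by
      filter_upwards [f.coeFn_toLp (p := 2) μ (𝕜 := ℂ)] with y hy
      rw [hy]; rfl
    exact ⟨(L2.integrable_inner v (f.toLp 2 μ ℂ)).congr hae.symm,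
      (integral_congr_ae hae).trans (L2.inner_def v _).symm⟩
  have hbirk : ∀ᵐ x ∂μ, ∀ f ∈ D, Tendsto
      (fun n => birkhoffAverage ℂ T (fun y => f y * (starRingEnd ℂ) (v y)) n x) atTop
      (𝓝 (inner ℂ v (f.toLp 2 μ ℂ))) := by
    refine (ae_ball_iff hDc).2 fun f _ => ?_
    rw [← (hint f).2]
    exact ae_tendsto_birkhoffAverage hE (f.continuous.measurable.mul
      (Complex.continuous_conj.measurable.comp (Lp.stronglyMeasurable v).measurable)) (hint f).1
  have hstep : ∀ᵐ x ∂μ, ∀ j : ℕ, v (T (T^[j] x)) = ξ * v (T^[j] x) :=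
    ae_all_iff.2 fun j => (hT.iterate j).quasiMeasurePreserving.ae
      (ae_comp_eq_of_koopman_eq_smul hv)
  filter_upwards [hbirk, hstep, ae_norm_eq_one hE hv h1] with x hx hstep hnorm
  refine ⟨v x, hnorm, fun f => ?_⟩
  have hiter (j : ℕ) : v (T^[j] x) = (ξ : ℂ) ^ j * v x := by
    induction j with
    | zero => simp
    | succ j ih => rw [Function.iterate_succ_apply', hstep, ih, pow_succ']; ring
  have hunit : v x * (starRingEnd ℂ) (v x) = 1 := by
    rw [Complex.mul_conj', hnorm]; simp
  have hconj (j : ℕ) : (starRingEnd ℂ) ((ξ : ℂ) ^ j) = (ξ : ℂ) ^ (-(j : ℤ)) := by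
    rw [map_pow, ← Circle.coe_inv_eq_conj, Circle.coe_inv, zpow_neg, zpow_natCast, inv_pow]
  -- Along the orbit `conj (v (T^j x)) = ξ^{-j} conj (v x)`, so the eigenfunction absorbs the twist.
  have hav (f : C(X, ℂ)) (n : ℕ) : av T f ξ n x =
      v x * birkhoffAverage ℂ T (fun y => f y * (starRingEnd ℂ) (v y)) n x := by
    simp only [av, birkhoffAverage, birkhoffSum, smul_eq_mul, one_div]
    rw [mul_left_comm, Finset.mul_sum _ _ (v x)]
    congr 1
    refine Finset.sum_congr rfl fun j _ => ?_
    rw [hiter, map_mul, hconj]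
    linear_combination (-((ξ : ℂ) ^ (-(j : ℤ)) * f (T^[j] x))) * hunit
  let a : C(X, ℂ) →L[ℂ] ℂ := v x • (innerSL ℂ v).comp (ContinuousMap.toLp 2 μ ℂ)
  refine tendsto_av_of_dense hD a (fun g hg => ?_) f
  simp only [hav]
  exact (hx g hg).const_mul (v x)

theorem isRegularWWGeneric_of_tendsto [IsFiniteMeasure μ] {hT : MeasurePreserving T μ μ}
    (hc : Continuous T) {x : X} (hx : IsGeneric T μ x) {e : eigenvalueSet hT → Lp ℂ 2 μ}
    (he : ∀ f, HasSum (fun ξ => ‖(inner ℂ (e ξ) f : ℂ)‖ ^ 2)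
      (‖(kronecker hT).starProjection f‖ ^ 2))
    (hlim : ∀ ξ : eigenvalueSet hT, ∃ c : ℂ, ‖c‖ = 1 ∧ ∀ f : C(X, ℂ),
      Tendsto (fun n => av T f ξ n x) atTop (𝓝 (c * inner ℂ (e ξ) (f.toLp 2 μ ℂ)))) :
    IsRegularWWGeneric hT x := by
  have hzero (f : C(X, ℂ)) {ξ : Circle} (hξ : ξ ∉ eigenvalueSet hT) :
      Tendsto (fun n => av T f ξ n x) atTop (𝓝 0) := hx.tendsto_av_zero hT hc hξ f
  have hww (f : C(X, ℂ)) (ξ : Circle) : Tendsto (fun n => av T f ξ n x) atTop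
      (𝓝 (avLim T f ξ x)) := by
    refine tendsto_nhds_limUnder ?_
    by_cases hξ : ξ ∈ eigenvalueSet hT
    · obtain ⟨c, -, hc⟩ := hlim ⟨ξ, hξ⟩
      exact ⟨_, hc f⟩
    · exact ⟨0, hzero f hξ⟩
  refine ⟨⟨hx, fun f ξ => ⟨_, hww f ξ⟩⟩, fun f => ?_⟩
  have hfreq (ξ : Circle) : ξ ∈ Freq T x ↔ ∃ g : C(X, ℂ), avLim T g ξ x ≠ 0 := by
    refine exists_congr fun g => ?_
    rw [(hww g ξ).norm.limsup_eq, norm_pos_iff]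
  have hterm (ξ : eigenvalueSet hT) : ‖(inner ℂ (e ξ) (f.toLp 2 μ ℂ) : ℂ)‖ ^ 2 =
      ‖avLim T f ξ x‖ ^ 2 := by
    obtain ⟨c, hc1, hc⟩ := hlim ξ
    rw [tendsto_nhds_unique (hww f ξ) (hc f), norm_mul, hc1, one_mul]
  have hsum := he (f.toLp 2 μ ℂ)
  simp only [hterm] at hsum
  -- Both sums are extended by zero to the circle: frequencies are eigenvalues, and an eigenvalue
  -- that is not a frequency contributes zero.
  have hs := (hasSum_subtype_iff_indicator (f := fun ξ => ‖avLim T f ξ x‖ ^ 2)).1 hsum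
  refine (hasSum_subtype_iff_indicator (f := fun ξ => ‖avLim T f ξ x‖ ^ 2)).2 ?_
  convert hs using 1
  ext ξ
  by_cases h1 : ξ ∈ Freq T x <;> by_cases h2 : ξ ∈ eigenvalueSet hT
  · rw [Set.indicator_of_mem h1, Set.indicator_of_mem h2]
  · obtain ⟨g, hg⟩ := (hfreq ξ).1 h1
    exact (hg (tendsto_nhds_unique (hww g ξ) (hzero g h2))).elim
  · rw [Set.indicator_of_notMem h1, Set.indicator_of_mem h2]
    have : avLim T f ξ x = 0 := by
      by_contra h
      exact h1 ((hfreq ξ).2 ⟨f, h⟩)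
    simp [this]
  · rw [Set.indicator_of_notMem h1, Set.indicator_of_notMem h2]

/-- For an ergodic measure, almost every point is a regular Wiener-Wintner generic point. -/
theorem ae_isRegularWWGeneric [IsProbabilityMeasure μ] (hE : Ergodic T μ)
    (hT : MeasurePreserving T μ μ) (hc : Continuous T) : ∀ᵐ x ∂μ, IsRegularWWGeneric hT x := by
  obtain ⟨e, hon, hUe, hsum⟩ := exists_eigenbasis hE hT
  have := (denseRange_toLp (X := X) (μ := μ)).separableSpace
    (ContinuousLinearMap.continuous _)
  have := countable_of_orthonormal hon
  filter_upwards [ae_isGeneric hE,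
    ae_all_iff.2 fun ξ => ae_tendsto_av_eigenvalue hE (hUe ξ) (hon.1 ξ)] with x hx hlim
  exact isRegularWWGeneric_of_tendsto hc hx hsum hlim

end Regular

end WienerWintner

end

/-! ### The equivalence -/

theorem mainTheorem3 {X : Type*} [MetricSpace X] [CompactSpace X] [MeasurableSpace X]
    [BorelSpace X] (T : X → X) (hcont : Continuous T) (μ : MeasureTheory.Measure X)
    [MeasureTheory.IsProbabilityMeasure μ] (hT : MeasureTheory.MeasurePreserving T μ μ) :
    List.TFAE [
      Ergodic T μ,
      ∃ A : Set X, MeasurableSet A ∧ μ A = 1 ∧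
        ∀ x ∈ A, WienerWintner.IsRegularWWGeneric hT x,
      ∃ x : X, WienerWintner.IsRegularWWGeneric hT x] := by
  tfae_have 1 → 2 := by
    intro hE
    obtain ⟨A, hA, hAm, h⟩ :=
      (WienerWintner.ae_isRegularWWGeneric hE hT hcont).exists_measurable_mem
    exact ⟨A, hAm, (mem_ae_iff_prob_eq_one hAm).1 hA, h⟩
  tfae_have 2 → 3 := by
    rintro ⟨A, -, hA, h⟩
    obtain ⟨x, hx⟩ := nonempty_of_measure_ne_zero (hA.trans_ne one_ne_zero)
    exact ⟨x, h x hx⟩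
  tfae_have 3 → 1 := fun ⟨x, hx⟩ => hx.ergodic hcont
  tfae_finish
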